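/- Throughout, a random projection $G:\mathbb{R}^m\to\mathbb{R}^d$ ($d\ge 1$) is a linear map whose matrix has i.i.d. $\mathcal{N}(0,1/d)$ entries. For a finite nonempty set $X$ of points of a Euclidean space and a nonempty $S\subseteq X$, the facility location cost is $\mathrm{cost}_X(S)=|S|+\sum_{x\in X}\min_{f\in S}\|x-f\|$; its minimum over all nonempty $S\subseteq X$ is $\mathrm{OPT}(X)$, and $S$ is optimal for $X$ if it attains the minimum. The doubling constant $\lambda_X$ is the least integer $\lambda$ such that for all $x\in X$ and $r>0$ the set $X\cap B(x,r)$ is covered by at most $\lambda$ balls of radius $r/2$ centred at points of $X$ (balls being closed), and the doubling dimension is $\log_2\lambda_X$. **Theorem.** Let $d=d(n)\ge 1$ be integers with $d(n)=o(\log n)$ as $n\to\infty$. Then there are reals $R_n\ge 1$ such that the sets $X_n=\{R_ne_1,\dots,R_ne_n\}\subset\mathbb{R}^n$ of $n$ points ($e_i$ the standard basis vectors) have doubling dimension $\Theta(\log n)$, and there are sequences $\varepsilon_n\to 0$ and $K_n\to\infty$ such that, for all sufficiently large $n$ and a random projection $G:\mathbb{R}^n\to\mathbb{R}^{d(n)}$: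 1. with probability at least $2/3$, $\mathrm{OPT}(GX_n)\le \varepsilon_n\cdot\mathrm{OPT}(X_n)$; 2. with probability at least $2/3$, every optimal set of facilities $\widetilde{\mathcal F}\subseteq GX_n$ for $GX_n$, pulled back to $\{x\in X_n: Gx\in\widetilde{\mathcal F}\}\subseteq X_n$, satisfies $\mathrm{cost}_{X_n}(\{x\in X_n: Gx\in\widetilde{\mathcal F}\})\ge K_n\cdot\mathrm{OPT}(X_n)$. -/

import Mathlib

open MeasureTheory ProbabilityTheory Filter Asymptotics
open scoped NNReal ENNReal Topology

noncomputable section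

namespace FacilityLocation

/-- `λ` is admissible for the finite point set `X` if for every `x ∈ X` and `r > 0` the part of `X`
in the ball `B(x, r)` is covered by at most `λ` balls of radius `r / 2` centred in `X`. -/
def IsDoublingBound {E : Type*} [PseudoMetricSpace E] (X : Finset E) (lam : ℕ) : Prop :=
  ∀ x ∈ X, ∀ r : ℝ, 0 < r → ∃ S : Finset E, S ⊆ X ∧ S.card ≤ lam ∧
    (X : Set E) ∩ Metric.closedBall x r ⊆ ⋃ s ∈ S, Metric.closedBall s (r / 2)

/-- The bound `|X|` is always admissible (so the infimum below is over a nonempty set). -/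
theorem isDoublingBound_card {E : Type*} [PseudoMetricSpace E] (X : Finset E) :
    IsDoublingBound X X.card := by
  intro x _ r hr
  refine ⟨X, subset_rfl, le_rfl, ?_⟩
  rintro y ⟨hy, -⟩
  exact Set.mem_iUnion₂.2 ⟨y, hy, Metric.mem_closedBall_self (by linarith)⟩

/-- The doubling constant of a finite point set: the least admissible `λ`. -/
def doublingConstant {E : Type*} [PseudoMetricSpace E] (X : Finset E) : ℕ :=
  sInf {lam : ℕ | IsDoublingBound X lam}

/-- The doubling dimension `log₂ λ_X`. -/
def doublingDimension {E : Type*} [PseudoMetricSpace E] (X : Finset E) : ℝ :=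
  Real.logb 2 (doublingConstant X)

/-- A solution of the facility location problem on `X`: a nonempty set of facilities in `X`. -/
def IsSolution {E : Type*} (X S : Finset E) : Prop :=
  S ⊆ X ∧ S.Nonempty

/-- The (uniform) facility location cost `|S| + ∑_{x ∈ X} min_{f ∈ S} dist x f`. -/
def cost {E : Type*} [PseudoMetricSpace E] (X S : Finset E) : ℝ :=
  (S.card : ℝ) + ∑ x ∈ X, Metric.infDist x (S : Set E)

/-- The optimal facility location cost of `X`. -/
def optCost {E : Type*} [PseudoMetricSpace E] (X : Finset E) : ℝ :=
  sInf (cost X '' {S | IsSolution X S})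

/-- `S` is an optimal set of facilities for `X`. -/
def IsOptimal {E : Type*} [PseudoMetricSpace E] (X S : Finset E) : Prop :=
  IsSolution X S ∧ ∀ S', IsSolution X S' → cost X S ≤ cost X S'

/-- A nonempty point set has an optimal set of facilities, and its cost is `optCost X`. -/
theorem exists_isOptimal {E : Type*} [PseudoMetricSpace E] (X : Finset E) (hX : X.Nonempty) :
    ∃ S, IsOptimal X S ∧ cost X S = optCost X := by
  have hfin : {S | IsSolution X S}.Finite :=
    (X.powerset.finite_toSet).subset fun S hS => by simpa using hS.1
  obtain ⟨S, hS, hmin⟩ := Set.exists_min_image _ (cost X) hfin ⟨X, subset_rfl, hX⟩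
  refine ⟨S, ⟨hS, hmin⟩, ?_⟩
  have h : IsLeast (cost X '' {S | IsSolution X S}) (cost X S) := by
    refine ⟨⟨S, hS, rfl⟩, ?_⟩
    rintro _ ⟨S', hS', rfl⟩
    exact hmin S' hS'
  exact h.csInf_eq.symm

/-- The law of a random projection from `ℝ^m` to `ℝ^d`: a `d × m` matrix with independent
`N(0, 1/d)` entries. -/
def randomProjection (m d : ℕ) : Measure (Fin d → Fin m → ℝ) :=
  Measure.pi fun _ : Fin d => Measure.pi fun _ : Fin m => gaussianReal 0 ((d : ℝ≥0)⁻¹)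

instance instIsProbabilityMeasureRandomProjection (m d : ℕ) :
    IsProbabilityMeasure (randomProjection m d) := by
  unfold randomProjection; infer_instance

/-- The linear map `x ↦ G x` between Euclidean spaces. -/
def proj {m d : ℕ} (G : Fin d → Fin m → ℝ) (x : EuclideanSpace ℝ (Fin m)) :
    EuclideanSpace ℝ (Fin d) :=
  WithLp.toLp 2 ((Matrix.of G).mulVec x.ofLp)

open Classical in
/-- The projected dataset `GX`. -/
def projSet {m d : ℕ} (G : Fin d → Fin m → ℝ) (X : Finset (EuclideanSpace ℝ (Fin m))) :
    Finset (EuclideanSpace ℝ (Fin d)) :=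
  X.image (proj G)

open Classical in
/-- The pullback to `X` of a set `S ⊆ GX` of facilities. -/
def pullback {m d : ℕ} (G : Fin d → Fin m → ℝ) (X : Finset (EuclideanSpace ℝ (Fin m)))
    (S : Finset (EuclideanSpace ℝ (Fin d))) : Finset (EuclideanSpace ℝ (Fin m)) :=
  X.filter fun x => proj G x ∈ S

end FacilityLocation

end

/-!
The points of `{R e₁, …, R eₙ}` are pairwise at distance `√2 R ≥ 1`, so opening every point is
optimal: `OPT = n`. Take `R = n ^ (1 / 4d)`, which tends to infinity because `d = o(log n)`.
Since `𝔼 ∑ᵢ ‖G eᵢ‖² = n`, with probability at least `2/3` all but `3n / R²` of the projected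
points lie in the ball of radius `R²`, and by a volume argument that ball contains a `4/R`-net of
at most `R ^ (3d) ≤ n / R` of them. Opening the outliers and the net costs at most `8n / R`, so
every optimal solution downstairs has at most `n / 2` facilities. Almost surely `G` is injective
on the points, so its pullback leaves at least `n / 2` points at distance `√2 R` from it.
-/

namespace FacilityLocation

section Nets

open Metric Module

variable {E : Type*} [NormedAddCommGroup E] [NormedSpace ℝ E] [FiniteDimensional ℝ E]

theorem card_le_of_isSeparated {s : Finset E} {x : E} {T : ℝ} {δ : ℝ≥0} (hT : 0 ≤ T)
    (hδ : 0 < δ) (hsT : (s : Set E) ⊆ closedBall x T) (hs : IsSeparated δ (s : Set E)) :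
    (s.card : ℝ) ≤ (1 + 2 * T / δ) ^ finrank ℝ E := by
  borelize E
  let μ : Measure E := Measure.addHaar
  have hδ' : (0 : ℝ) < δ := hδ
  have hdisj : (s : Set E).PairwiseDisjoint fun c => closedBall c (δ / 2 : ℝ) := by
    intro c hc c' hc' hne
    have hsep : (δ : ℝ) < dist c c' := by
      simpa only [edist_nndist, ENNReal.coe_lt_coe, ← NNReal.coe_lt_coe, coe_nndist]
        using hs hc hc' hne
    exact closedBall_disjoint_closedBall (by linarith)
  have hsub : ⋃ c ∈ s, closedBall c (δ / 2 : ℝ) ⊆ closedBall x (T + δ / 2) :=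
    Set.iUnion₂_subset fun c hc => closedBall_subset_closedBall' <| by
      linarith [mem_closedBall.1 (hsT hc)]
  have hvol : s.card * (δ / 2 : ℝ) ^ finrank ℝ E * μ.real (ball 0 1) ≤
      (T + δ / 2) ^ finrank ℝ E * μ.real (ball 0 1) := by
    calc s.card * (δ / 2 : ℝ) ^ finrank ℝ E * μ.real (ball 0 1)
        = ∑ c ∈ s, μ.real (closedBall c (δ / 2 : ℝ)) := by
          simp only [μ.addHaar_real_closedBall _ (half_pos hδ').le, Finset.sum_const,
            nsmul_eq_mul, mul_assoc]
      _ = μ.real (⋃ c ∈ s, closedBall c (δ / 2 : ℝ)) :=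
          (measureReal_biUnion_finset hdisj (fun _ _ => measurableSet_closedBall)
            fun _ _ => measure_closedBall_lt_top.ne).symm
      _ ≤ μ.real (closedBall x (T + δ / 2)) :=
          measureReal_mono hsub measure_closedBall_lt_top.ne
      _ = (T + δ / 2) ^ finrank ℝ E * μ.real (ball 0 1) :=
          μ.addHaar_real_closedBall _ (by positivity)
  have hball : 0 < μ.real (ball (0 : E) 1) :=
    ENNReal.toReal_pos (measure_ball_pos μ _ one_pos).ne' measure_ball_lt_top.ne
  have hratio : 1 + 2 * T / δ = (T + δ / 2) / (δ / 2) := by field_simp; ring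
  rw [hratio, div_pow, le_div_iff₀ (by positivity)]
  exact le_of_mul_le_mul_right hvol hball

theorem exists_isCover_card_le (s : Finset E) {x : E} {T : ℝ} {δ : ℝ≥0} (hT : 0 ≤ T)
    (hδ : 0 < δ) (hsT : (s : Set E) ⊆ closedBall x T) :
    ∃ N ⊆ s, IsCover δ (s : Set E) N ∧ (N.card : ℝ) ≤ (1 + 2 * T / δ) ^ finrank ℝ E := by
  have hpack : packingNumber δ (s : Set E) ≠ ⊤ :=
    ne_top_of_le_ne_top s.finite_toSet.encard_lt_top.ne (packingNumber_le_encard_self _)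
  have hfin : (maximalSeparatedSet δ (s : Set E)).Finite :=
    s.finite_toSet.subset maximalSeparatedSet_subset
  have hsub : hfin.toFinset ⊆ s :=
    hfin.toFinset_subset.2 maximalSeparatedSet_subset
  refine ⟨hfin.toFinset, hsub, ?_, card_le_of_isSeparated hT hδ
    ((Finset.coe_subset.2 hsub).trans hsT) ?_⟩ <;> rw [hfin.coe_toFinset]
  · exact isCover_maximalSeparatedSet hpack
  · exact isSeparated_maximalSeparatedSet

end Nets

section Cost

variable {E : Type*} [PseudoMetricSpace E] {X S : Finset E}

theorem card_le_cost (X S : Finset E) : (S.card : ℝ) ≤ cost X S :=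
  le_add_of_nonneg_right (Finset.sum_nonneg fun _ _ => Metric.infDist_nonneg)

theorem optCost_le_cost (hS : IsSolution X S) : optCost X ≤ cost X S := by
  refine csInf_le ⟨0, ?_⟩ ⟨S, hS, rfl⟩
  rintro _ ⟨S', -, rfl⟩
  exact (Nat.cast_nonneg _).trans (card_le_cost X S')

theorem IsOptimal.cost_eq_optCost (hS : IsOptimal X S) : cost X S = optCost X :=
  le_antisymm (le_csInf ⟨_, S, hS.1, rfl⟩ (Set.forall_mem_image.2 hS.2)) (optCost_le_cost hS.1)

theorem cost_le_of_isCover {δ : ℝ≥0} (h : Metric.IsCover δ (X : Set E) S) :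
    cost X S ≤ S.card + X.card * δ := by
  have hdist : ∀ x ∈ X, Metric.infDist x S ≤ δ := fun x hx => by
    obtain ⟨y, hy, hxy⟩ := h hx
    exact (Metric.infDist_le_dist_of_mem hy).trans (edist_le_coe.1 hxy)
  unfold cost
  gcongr
  simpa only [nsmul_eq_mul] using Finset.sum_le_card_nsmul X _ _ hdist

/-- All distinct points of `X` are at distance exactly `D`, as for the vertices of a regular
simplex with edge length `D`. -/
def IsEquidistant (X : Finset E) (D : ℝ) : Prop :=
  (X : Set E).Pairwise fun x y => dist x y = D

namespace IsEquidistant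

variable {D : ℝ}

theorem infDist_eq (h : IsEquidistant X D) (hS : IsSolution X S) {x : E} (hx : x ∈ X)
    (hxS : x ∉ S) : Metric.infDist x S = D := by
  have hdist : ∀ y ∈ S, dist x y = D := fun y hy =>
    h hx (hS.1 hy) (ne_of_mem_of_not_mem hy hxS).symm
  obtain ⟨y, hy⟩ := hS.2
  refine le_antisymm ((Metric.infDist_le_dist_of_mem hy).trans_eq (hdist y hy)) ?_
  exact (Metric.le_infDist ⟨y, hy⟩).2 fun z hz => (hdist z hz).ge

theorem cost_eq (h : IsEquidistant X D) (hS : IsSolution X S) :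
    cost X S = S.card + (X.card - S.card) * D := by
  classical
  have hin : ∑ x ∈ S, Metric.infDist x S = 0 :=
    Finset.sum_eq_zero fun x hx => Metric.infDist_zero_of_mem hx
  have hout : ∑ x ∈ X \ S, Metric.infDist x S = ((X \ S).card : ℝ) * D := by
    rw [← nsmul_eq_mul]
    exact Finset.sum_eq_card_nsmul fun x hx =>
      h.infDist_eq hS (Finset.mem_sdiff.1 hx).1 (Finset.mem_sdiff.1 hx).2
  rw [cost, ← Finset.sum_sdiff hS.1, hin, hout, add_zero, Finset.cast_card_sdiff hS.1]

theorem optCost_eq_card (h : IsEquidistant X D) (hX : X.Nonempty) (hD : 1 ≤ D) :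
    optCost X = X.card := by
  refine le_antisymm ?_ ?_
  · have hself : IsSolution X X := ⟨subset_rfl, hX⟩
    simpa only [h.cost_eq hself, sub_self, zero_mul, add_zero] using optCost_le_cost hself
  · obtain ⟨S, hS, hopt⟩ := exists_isOptimal X hX
    have hcard : (S.card : ℝ) ≤ X.card := Nat.cast_le.2 (Finset.card_le_card hS.1.1)
    rw [← hopt, h.cost_eq hS.1]
    nlinarith

theorem half_mul_card_le_cost (h : IsEquidistant X D) (hD : 0 ≤ D) (hS : IsSolution X S)
    (hcard : (S.card : ℝ) ≤ X.card / 2) : D / 2 * X.card ≤ cost X S := by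
  rw [h.cost_eq hS]
  nlinarith [(Nat.cast_nonneg S.card : (0 : ℝ) ≤ S.card)]

theorem doublingConstant_eq_card (h : IsEquidistant X D) (hD : 0 < D) :
    doublingConstant X = X.card := by
  refine le_antisymm (Nat.sInf_le (isDoublingBound_card X))
    (le_csInf ⟨_, isDoublingBound_card X⟩ fun lam hlam => ?_)
  rcases X.eq_empty_or_nonempty with rfl | ⟨x, hx⟩
  · exact Nat.zero_le _
  -- The ball of radius `D` is everything, while balls of radius `D / 2` contain a single point.
  obtain ⟨S, hSX, hcard, hcov⟩ := hlam x hx D hD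
  refine (Finset.card_le_card fun y hy => ?_).trans hcard
  have hball : y ∈ Metric.closedBall x D := by
    rcases eq_or_ne y x with rfl | hne
    · exact Metric.mem_closedBall_self hD.le
    · exact (h hy hx hne).le
  obtain ⟨s, hs, hys⟩ := Set.mem_iUnion₂.1 (hcov ⟨hy, hball⟩)
  by_contra hyS
  have hdist : dist y s = D := h hy (hSX hs) (ne_of_mem_of_not_mem hs hyS).symm
  rw [Metric.mem_closedBall, hdist] at hys
  linarith

end IsEquidistant

end Cost

section LowDimension

open Module

theorem card_filter_lt_norm_le {E : Type*} [SeminormedAddCommGroup E] (P : Finset E) {T : ℝ}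
    (hT : 0 < T) : ((P.filter fun x => T < ‖x‖).card : ℝ) ≤ (∑ x ∈ P, ‖x‖ ^ 2) / T ^ 2 := by
  rw [le_div_iff₀ (by positivity), ← nsmul_eq_mul]
  calc (P.filter fun x => T < ‖x‖).card • T ^ 2
      ≤ ∑ x ∈ P with T < ‖x‖, ‖x‖ ^ 2 := Finset.card_nsmul_le_sum _ _ _ fun x hx =>
        pow_le_pow_left₀ hT.le (Finset.mem_filter.1 hx).2.le 2
    _ ≤ ∑ x ∈ P, ‖x‖ ^ 2 := Finset.sum_le_sum_of_subset_of_nonneg (Finset.filter_subset _ _)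
        fun x _ _ => sq_nonneg ‖x‖

variable {E : Type*} [NormedAddCommGroup E] [NormedSpace ℝ E] [FiniteDimensional ℝ E]
  {P : Finset E}

theorem optCost_le_sum_norm_sq_div_add (hP : P.Nonempty) {T δ : ℝ} (hT : 0 < T) (hδ : 0 < δ) :
    optCost P ≤
      (∑ x ∈ P, ‖x‖ ^ 2) / T ^ 2 + (1 + 2 * T / δ) ^ finrank ℝ E + P.card * δ := by
  classical
  lift δ to ℝ≥0 using hδ.le
  let far := P.filter fun x => T < ‖x‖
  let near := P.filter fun x => ¬T < ‖x‖
  have hnear : (near : Set E) ⊆ Metric.closedBall 0 T := fun x hx =>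
    mem_closedBall_zero_iff.2 (not_lt.1 (Finset.mem_filter.1 hx).2)
  obtain ⟨N, hN, hcov, hNcard⟩ := exists_isCover_card_le near hT.le (NNReal.coe_pos.1 hδ) hnear
  have hcov' : Metric.IsCover δ (P : Set E) (far ∪ N : Finset E) := fun x hx => by
    rw [Finset.coe_union]
    by_cases hxT : T < ‖x‖
    · exact (Metric.IsCover.refl δ (far : Set E)).mono Set.subset_union_left
        (Finset.mem_filter.2 ⟨hx, hxT⟩)
    · exact hcov.mono Set.subset_union_right (Finset.mem_filter.2 ⟨hx, hxT⟩)
  have hsol : IsSolution P (far ∪ N) :=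
    ⟨Finset.union_subset (Finset.filter_subset _ _) (hN.trans (Finset.filter_subset _ _)),
      Finset.coe_nonempty.1 (hcov'.nonempty (Finset.coe_nonempty.2 hP))⟩
  calc optCost P ≤ (far ∪ N).card + P.card * δ :=
        (optCost_le_cost hsol).trans (cost_le_of_isCover hcov')
    _ ≤ far.card + N.card + P.card * δ := by
        gcongr
        exact_mod_cast Finset.card_union_le far N
    _ ≤ _ := by
        gcongr
        exact card_filter_lt_norm_le P hT

theorem optCost_le_of_sum_norm_sq_le (hP : P.Nonempty) (hE : 0 < finrank ℝ E) {a : ℝ}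
    (ha : 2 ≤ a) (hcard : (P.card : ℝ) ≤ a ^ (4 * finrank ℝ E))
    (hsum : ∑ x ∈ P, ‖x‖ ^ 2 ≤ 3 * a ^ 2 * a ^ (4 * finrank ℝ E)) :
    optCost P ≤ 8 / a * a ^ (4 * finrank ℝ E) := by
  set k := finrank ℝ E
  have ha1 : 1 ≤ a := by linarith
  have hfar : (∑ x ∈ P, ‖x‖ ^ 2) / (a ^ 2) ^ 2 ≤ 3 / a * a ^ (4 * k) :=
    calc (∑ x ∈ P, ‖x‖ ^ 2) / (a ^ 2) ^ 2 ≤ 3 * a ^ 2 * a ^ (4 * k) / (a ^ 2) ^ 2 := by gcongr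
      _ = 3 / a ^ 2 * a ^ (4 * k) := by field_simp
      _ ≤ 3 / a * a ^ (4 * k) := by
        gcongr
        exact le_self_pow₀ ha1 two_ne_zero
  have hnet : (1 + 2 * a ^ 2 / (4 / a)) ^ k ≤ 1 / a * a ^ (4 * k) := by
    have hbase : 1 + 2 * a ^ 2 / (4 / a) ≤ a ^ 3 := by
      have : 2 ≤ a ^ 3 := ha.trans (le_self_pow₀ ha1 three_ne_zero)
      calc 1 + 2 * a ^ 2 / (4 / a) = 1 + a ^ 3 / 2 := by field_simp; ring
        _ ≤ a ^ 3 := by linarith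
    rw [one_div_mul_eq_div, le_div_iff₀ (by positivity)]
    calc (1 + 2 * a ^ 2 / (4 / a)) ^ k * a ≤ (a ^ 3) ^ k * a := by gcongr
      _ = a ^ (3 * k + 1) := by rw [← pow_mul, pow_succ]
      _ ≤ a ^ (4 * k) := pow_le_pow_right₀ ha1 (by omega)
  calc optCost P ≤ (∑ x ∈ P, ‖x‖ ^ 2) / (a ^ 2) ^ 2 + (1 + 2 * a ^ 2 / (4 / a)) ^ k +
        P.card * (4 / a) := optCost_le_sum_norm_sq_div_add hP (by positivity) (by positivity)
    _ ≤ 3 / a * a ^ (4 * k) + 1 / a * a ^ (4 * k) + a ^ (4 * k) * (4 / a) := by gcongr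
    _ = 8 / a * a ^ (4 * k) := by ring

end LowDimension

section Probability

variable {Ω : Type*} {mΩ : MeasurableSpace Ω} {μ : Measure Ω}

theorem one_sub_integral_div_le_measureReal_le [IsProbabilityMeasure μ] {f : Ω → ℝ}
    (hf : 0 ≤ᵐ[μ] f) (hint : Integrable f μ) {t : ℝ} (ht : 0 < t) :
    1 - (∫ ω, f ω ∂μ) / t ≤ μ.real {ω | f ω ≤ t} := by
  have hmarkov : μ.real {ω | t ≤ f ω} ≤ (∫ ω, f ω ∂μ) / t :=
    (le_div_iff₀' ht).2 (mul_meas_ge_le_integral_of_nonneg hf hint t)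
  have hunion : 1 ≤ μ.real {ω | f ω ≤ t} + μ.real {ω | t ≤ f ω} := by
    rw [← probReal_univ (μ := μ), ← Set.eq_univ_of_forall fun ω => le_total (f ω) t]
    exact measureReal_union_le _ _
  linarith

theorem ae_ne_of_indepFun [IsFiniteMeasure μ] {α : Type*} [MeasurableSpace α] [MeasurableEq α]
    {X Y : Ω → α} (hX : AEMeasurable X μ) (hY : AEMeasurable Y μ)
    [NullSingletonClass (μ.map Y)] (hXY : IndepFun X Y μ) : ∀ᵐ ω ∂μ, X ω ≠ Y ω := by
  have hprod : ∀ᵐ p ∂(μ.map X).prod (μ.map Y), p.1 ≠ p.2 :=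
    (Measure.ae_prod_iff_ae_ae measurableSet_diagonal.compl).2
      (ae_of_all _ fun x => ((μ.map Y).ae_ne x).mono fun _ => Ne.symm)
  rw [← (indepFun_iff_map_prod_eq_prod_map_map hX hY).1 hXY] at hprod
  exact ae_of_ae_map (hX.prodMk hY) hprod

end Probability

section RandomProjection

variable {m d : ℕ}

theorem hasLaw_row (k : Fin d) :
    HasLaw (fun G => G k) (Measure.pi fun _ : Fin m => gaussianReal 0 (d : ℝ≥0)⁻¹)
      (randomProjection m d) :=
  (measurePreserving_eval
    (fun _ : Fin d => Measure.pi fun _ : Fin m => gaussianReal 0 (d : ℝ≥0)⁻¹) k).hasLaw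

theorem hasLaw_entry (k : Fin d) (i : Fin m) :
    HasLaw (fun G => G k i) (gaussianReal 0 (d : ℝ≥0)⁻¹) (randomProjection m d) :=
  (measurePreserving_eval _ i).fun_comp_hasLaw (hasLaw_row k)

theorem integrable_entry_sq (k : Fin d) (i : Fin m) :
    Integrable (fun G => G k i ^ 2) (randomProjection m d) := by
  have hlaw := hasLaw_entry k i
  have hgauss : MemLp id 2 ((randomProjection m d).map fun G => G k i) :=
    hlaw.map_eq ▸ memLp_id_gaussianReal 2
  exact (hgauss.comp_of_map hlaw.aemeasurable).integrable_sq

theorem integral_entry_sq (k : Fin d) (i : Fin m) :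
    ∫ G, G k i ^ 2 ∂randomProjection m d = (d : ℝ)⁻¹ := by
  have hmean : ∫ G, G k i ∂randomProjection m d = 0 := by
    rw [(hasLaw_entry k i).integral_eq, integral_id_gaussianReal]
  rw [← variance_of_integral_eq_zero (hasLaw_entry k i).aemeasurable hmean,
    (hasLaw_entry k i).variance_eq, variance_id_gaussianReal, NNReal.coe_inv, NNReal.coe_natCast]

theorem integral_sum_entry_sq (hd : 0 < d) :
    ∫ G, ∑ i, ∑ k, G k i ^ 2 ∂randomProjection m d = m := by
  have hcol (i : Fin m) : ∫ G, ∑ k, G k i ^ 2 ∂randomProjection m d = 1 := by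
    simp only [integral_finsetSum _ fun k _ => integrable_entry_sq k i, integral_entry_sq,
      Finset.sum_const, Finset.card_fin, nsmul_eq_mul]
    exact mul_inv_cancel₀ (by positivity)
  simp only [integral_finsetSum _ fun i _ => integrable_finsetSum _ fun k _ =>
    integrable_entry_sq k i, hcol, Finset.sum_const, Finset.card_fin, nsmul_eq_mul, mul_one]

theorem two_thirds_le_measure_sum_entry_sq_le (hm : 0 < m) (hd : 0 < d) :
    2 / 3 ≤ randomProjection m d {G | ∑ i, ∑ k, G k i ^ 2 ≤ 3 * (m : ℝ)} := by
  have hmarkov := one_sub_integral_div_le_measureReal_le (μ := randomProjection m d)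
    (f := fun G => ∑ i, ∑ k, G k i ^ 2) (ae_of_all _ fun G => by positivity)
    (integrable_finsetSum _ fun i _ => integrable_finsetSum _ fun k _ => integrable_entry_sq k i)
    (t := 3 * m) (by positivity)
  have hvalue : 1 - (m : ℝ) / (3 * m) = 2 / 3 := by field_simp; norm_num
  rw [integral_sum_entry_sq hd, hvalue] at hmarkov
  rw [← ofReal_measureReal]
  refine le_trans (le_of_eq ?_) (ENNReal.ofReal_le_ofReal hmarkov)
  rw [ENNReal.ofReal_div_of_pos three_pos, ENNReal.ofReal_ofNat, ENNReal.ofReal_ofNat]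

theorem ae_entry_ne (k : Fin d) {i j : Fin m} (hij : i ≠ j) :
    ∀ᵐ G ∂randomProjection m d, G k i ≠ G k j := by
  have hrow : ∀ᵐ x ∂Measure.pi fun _ : Fin m => gaussianReal 0 (d : ℝ≥0)⁻¹, x i ≠ x j := by
    have hpos : 0 < d := k.pos
    have : NullSingletonClass (gaussianReal 0 (d : ℝ≥0)⁻¹) :=
      nullSingletonClass_gaussianReal (by positivity)
    have : NullSingletonClass
        ((Measure.pi fun _ : Fin m => gaussianReal 0 (d : ℝ≥0)⁻¹).map fun x => x j) := by
      rwa [(measurePreserving_eval _ j).map_eq]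
    exact ae_ne_of_indepFun (measurable_pi_apply i).aemeasurable
      (measurable_pi_apply j).aemeasurable
      ((iIndepFun_pi (X := fun _ => id) fun _ => aemeasurable_id).indepFun hij)
  exact ae_of_ae_map (hasLaw_row k).aemeasurable (by rwa [(hasLaw_row k).map_eq])

theorem ae_injective_columns (hd : 0 < d) :
    ∀ᵐ G ∂randomProjection m d, Function.Injective fun (i : Fin m) (k : Fin d) => G k i := by
  have hrow : ∀ᵐ G ∂randomProjection m d, ∀ i j, i ≠ j → G ⟨0, hd⟩ i ≠ G ⟨0, hd⟩ j := by
    simpa only [ae_all_iff] using fun i j => ae_entry_ne ⟨0, hd⟩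
  filter_upwards [hrow] with G hG i j hij
  exact not_imp_not.1 (hG i j) (congrFun hij ⟨0, hd⟩)

end RandomProjection

section Pullback

variable {m d : ℕ} {G : Fin d → Fin m → ℝ} {X : Finset (EuclideanSpace ℝ (Fin m))}
  {S : Finset (EuclideanSpace ℝ (Fin d))}

open Classical in
theorem image_proj_pullback (hS : S ⊆ projSet G X) :
    (pullback G X S).image (proj G) = S := by
  ext y
  simp only [pullback, Finset.mem_image, Finset.mem_filter]
  refine ⟨by rintro ⟨x, ⟨-, hx⟩, rfl⟩; exact hx, fun hy => ?_⟩
  obtain ⟨x, hx, rfl⟩ := Finset.mem_image.1 (hS hy)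
  exact ⟨x, ⟨hx, hy⟩, rfl⟩

theorem card_pullback (hG : Set.InjOn (proj G) X) (hS : S ⊆ projSet G X) :
    (pullback G X S).card = S.card := by
  classical
  have hinj : Set.InjOn (proj G) (pullback G X S) :=
    hG.mono (Finset.coe_subset.2 (Finset.filter_subset _ _))
  rw [← Finset.card_image_of_injOn hinj, image_proj_pullback hS]

theorem IsSolution.pullback (hS : IsSolution (projSet G X) S) :
    IsSolution X (pullback G X S) := by
  classical
  have himage : ((FacilityLocation.pullback G X S).image (proj G)).Nonempty := by
    rw [image_proj_pullback hS.1]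
    exact hS.2
  exact ⟨Finset.filter_subset _ _, Finset.image_nonempty.1 himage⟩

theorem sum_norm_sq_projSet_le (G : Fin d → Fin m → ℝ) (X : Finset (EuclideanSpace ℝ (Fin m))) :
    ∑ y ∈ projSet G X, ‖y‖ ^ 2 ≤ ∑ x ∈ X, ‖proj G x‖ ^ 2 := by
  classical
  exact Finset.sum_image_le_of_nonneg fun _ _ => sq_nonneg _

end Pullback

section ScaledBasis

variable {n d : ℕ} {R : ℝ}

open Classical in
/-- The point set `{R e₁, …, R eₙ} ⊆ ℝⁿ`. -/
noncomputable def scaledBasis (n : ℕ) (R : ℝ) : Finset (EuclideanSpace ℝ (Fin n)) :=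
  Finset.univ.image fun i => R • EuclideanSpace.single i (1 : ℝ)

theorem coe_scaledBasis (n : ℕ) (R : ℝ) :
    (scaledBasis n R : Set (EuclideanSpace ℝ (Fin n))) =
      Set.range fun i => R • EuclideanSpace.single i (1 : ℝ) := by
  simp only [scaledBasis, Finset.coe_image, Finset.coe_univ, Set.image_univ]

theorem smul_single_injective (hR : R ≠ 0) :
    Function.Injective fun i : Fin n => R • EuclideanSpace.single i (1 : ℝ) :=
  (smul_right_injective _ hR).comp EuclideanSpace.orthonormal_single.linearIndependent.injective

theorem card_scaledBasis (hR : R ≠ 0) : (scaledBasis n R).card = n := by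
  rw [scaledBasis, Finset.card_image_of_injective _ (smul_single_injective hR), Finset.card_fin]

theorem isEquidistant_scaledBasis (hR : 0 ≤ R) : IsEquidistant (scaledBasis n R) (R * √2) := by
  rw [IsEquidistant, coe_scaledBasis]
  rintro _ ⟨i, rfl⟩ _ ⟨j, rfl⟩ hne
  have hij : i ≠ j := by rintro rfl; exact hne rfl
  have horth : inner ℝ (EuclideanSpace.single i (1 : ℝ)) (EuclideanSpace.single j 1) = 0 :=
    EuclideanSpace.orthonormal_single.2 hij
  rw [dist_smul₀, Real.norm_of_nonneg hR, dist_eq_norm,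
    norm_sub_eq_sqrt_iff_real_inner_eq_zero.2 horth]
  norm_num

theorem proj_smul_single (G : Fin d → Fin n → ℝ) (R : ℝ) (i : Fin n) :
    proj G (R • EuclideanSpace.single i (1 : ℝ)) = R • WithLp.toLp 2 fun k => G k i := by
  ext k
  simp [proj, Matrix.mulVec_smul]

theorem sum_norm_sq_proj_scaledBasis (G : Fin d → Fin n → ℝ) (hR : R ≠ 0) :
    ∑ x ∈ scaledBasis n R, ‖proj G x‖ ^ 2 = R ^ 2 * ∑ i, ∑ k, G k i ^ 2 := by
  rw [scaledBasis, Finset.sum_image (smul_single_injective hR).injOn, Finset.mul_sum]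
  simp only [proj_smul_single, norm_smul, mul_pow, Real.norm_eq_abs, sq_abs,
    EuclideanSpace.real_norm_sq_eq]

theorem injOn_proj_scaledBasis {G : Fin d → Fin n → ℝ} (hR : R ≠ 0)
    (hG : Function.Injective fun (i : Fin n) (k : Fin d) => G k i) :
    Set.InjOn (proj G) (scaledBasis n R) := by
  rw [coe_scaledBasis]
  rintro _ ⟨i, rfl⟩ _ ⟨j, rfl⟩ hij
  simp only [proj_smul_single] at hij
  rw [hG (WithLp.toLp_injective 2 (smul_right_injective _ hR hij))]

theorem optCost_scaledBasis (hn : 0 < n) (hR : 1 ≤ R) : optCost (scaledBasis n R) = n := by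
  have hcard : (scaledBasis n R).card = n := card_scaledBasis (by positivity)
  rw [(isEquidistant_scaledBasis (by positivity)).optCost_eq_card
    (Finset.card_pos.1 (hcard.symm ▸ hn))
    (one_le_mul_of_one_le_of_one_le hR (Real.one_le_sqrt.2 one_le_two)), hcard]

theorem doublingDimension_scaledBasis (hR : 0 < R) :
    doublingDimension (scaledBasis n R) = Real.logb 2 n := by
  rw [doublingDimension, (isEquidistant_scaledBasis hR.le).doublingConstant_eq_card
    (by positivity), card_scaledBasis hR.ne']

end ScaledBasis

section Distortion

variable {n d : ℕ} {R : ℝ}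

theorem optCost_projSet_scaledBasis_le (hn : 0 < n) (hd : 0 < d) (hR : 2 ≤ R)
    (hRn : R ^ (4 * d) = n) {G : Fin d → Fin n → ℝ} (hG : ∑ i, ∑ k, G k i ^ 2 ≤ 3 * (n : ℝ)) :
    optCost (projSet G (scaledBasis n R)) ≤ 8 / R * n := by
  have hcard : (scaledBasis n R).card = n := card_scaledBasis (by positivity)
  have hne : (projSet G (scaledBasis n R)).Nonempty :=
    (Finset.card_pos.1 (hcard.symm ▸ hn)).image _
  have hsum : ∑ y ∈ projSet G (scaledBasis n R), ‖y‖ ^ 2 ≤ 3 * R ^ 2 * n :=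
    calc ∑ y ∈ projSet G (scaledBasis n R), ‖y‖ ^ 2
        ≤ ∑ x ∈ scaledBasis n R, ‖proj G x‖ ^ 2 := sum_norm_sq_projSet_le G _
      _ = R ^ 2 * ∑ i, ∑ k, G k i ^ 2 := sum_norm_sq_proj_scaledBasis G (by positivity)
      _ ≤ R ^ 2 * (3 * n) := by gcongr
      _ = 3 * R ^ 2 * n := by ring
  have hrank : Module.finrank ℝ (EuclideanSpace ℝ (Fin d)) = d := finrank_euclideanSpace_fin
  have hbound := optCost_le_of_sum_norm_sq_le hne (hrank.symm ▸ hd) hR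
  rw [hrank, hRn] at hbound
  exact hbound (Nat.cast_le.2 (Finset.card_image_le.trans_eq hcard)) hsum

theorem le_cost_pullback_scaledBasis (hR : 0 < R) {G : Fin d → Fin n → ℝ}
    (hG : Function.Injective fun (i : Fin n) (k : Fin d) => G k i)
    {S : Finset (EuclideanSpace ℝ (Fin d))} (hS : IsSolution (projSet G (scaledBasis n R)) S)
    (hcard : (S.card : ℝ) ≤ n / 2) :
    R / 2 * n ≤ cost (scaledBasis n R) (pullback G (scaledBasis n R) S) := by
  have hX : (scaledBasis n R).card = n := card_scaledBasis hR.ne'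
  have hpull : (pullback G (scaledBasis n R) S).card = S.card :=
    card_pullback (injOn_proj_scaledBasis hR.ne' hG) hS.1
  calc R / 2 * n ≤ R * √2 / 2 * (scaledBasis n R).card := by
        rw [hX]
        gcongr
        exact le_mul_of_one_le_right hR.le (Real.one_le_sqrt.2 one_le_two)
    _ ≤ _ := (isEquidistant_scaledBasis hR.le).half_mul_card_le_cost (by positivity)
        hS.pullback (by rwa [hX, hpull])

theorem two_thirds_le_measure_optCost_projSet_le (hn : 0 < n) (hd : 0 < d) (hR : 2 ≤ R)
    (hRn : R ^ (4 * d) = n) :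
    2 / 3 ≤ randomProjection n d {G | optCost (projSet G (scaledBasis n R)) ≤
      8 / R * optCost (scaledBasis n R)} := by
  refine (two_thirds_le_measure_sum_entry_sq_le hn hd).trans (measure_mono fun G hG => ?_)
  rw [Set.mem_ofPred_eq, optCost_scaledBasis hn (by linarith)]
  exact optCost_projSet_scaledBasis_le hn hd hR hRn hG

theorem two_thirds_le_measure_le_cost_pullback (hn : 0 < n) (hd : 0 < d) (hR : 16 ≤ R)
    (hRn : R ^ (4 * d) = n) :
    2 / 3 ≤ randomProjection n d {G | ∀ S, IsOptimal (projSet G (scaledBasis n R)) S →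
      R / 2 * optCost (scaledBasis n R) ≤
        cost (scaledBasis n R) (pullback G (scaledBasis n R) S)} := by
  refine (two_thirds_le_measure_sum_entry_sq_le hn hd).trans (measure_mono_ae ?_)
  filter_upwards [ae_injective_columns hd] with G hinj hG S hS
  rw [optCost_scaledBasis hn (by linarith)]
  refine le_cost_pullback_scaledBasis (by linarith) hinj hS.1 ?_
  calc (S.card : ℝ) ≤ cost (projSet G (scaledBasis n R)) S := card_le_cost _ _
    _ = optCost (projSet G (scaledBasis n R)) := hS.cost_eq_optCost
    _ ≤ 8 / R * n := optCost_projSet_scaledBasis_le hn hd (by linarith) hRn hG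
    _ ≤ 8 / 16 * n := by gcongr
    _ = n / 2 := by ring

end Distortion

section Scale

/-- The scale `R = n ^ (1 / (4 d))` of the point set, chosen so that a net of at most `R ^ (3 d)`
points is a vanishing fraction of `n`. Written with `exp` so that it is at least `1` at `n = 0`
too. -/
noncomputable def scale (n d : ℕ) : ℝ :=
  Real.exp (Real.log n / (4 * d))

theorem one_le_scale (n d : ℕ) : 1 ≤ scale n d :=
  Real.one_le_exp (div_nonneg (Real.log_natCast_nonneg n) (by positivity))

theorem scale_pow {n d : ℕ} (hn : 0 < n) (hd : 0 < d) : scale n d ^ (4 * d) = n := by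
  rw [scale, ← Real.exp_nat_mul, Nat.cast_mul, Nat.cast_ofNat,
    mul_div_cancel₀ _ (by positivity), Real.exp_log (by positivity)]

theorem tendsto_scale {d : ℕ → ℕ} (hd_pos : ∀ n, 0 < d n)
    (hd : (fun n => (d n : ℝ)) =o[atTop] fun n : ℕ => Real.log n) :
    Tendsto (fun n => scale n (d n)) atTop atTop := by
  have hratio : Tendsto (fun n : ℕ => (d n : ℝ) / Real.log n) atTop (𝓝[>] 0) := by
    refine tendsto_nhdsWithin_iff.2 ⟨hd.tendsto_div_nhds_zero, ?_⟩
    filter_upwards [eventually_gt_atTop 1] with n hn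
    exact div_pos (Nat.cast_pos.2 (hd_pos n)) (Real.log_pos (Nat.one_lt_cast.2 hn))
  refine Real.tendsto_exp_atTop.comp ?_
  refine (hratio.inv_tendsto_nhdsGT_zero.atTop_div_const four_pos).congr fun n => ?_
  rw [Pi.inv_apply, inv_div, div_div, mul_comm]

end Scale

end FacilityLocation

open FacilityLocation

theorem theorem6p1 (d : ℕ → ℕ) (hd_pos : ∀ n, 1 ≤ d n)
    (hd : (fun n : ℕ => (d n : ℝ)) =o[atTop] (fun n : ℕ => Real.log (n : ℝ))) :
    ∃ (R : ℕ → ℝ) (X : (n : ℕ) → Finset (EuclideanSpace ℝ (Fin n))),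
      (∀ n, 1 ≤ R n ∧
        (X n : Set (EuclideanSpace ℝ (Fin n))) =
          Set.range (fun i : Fin n => R n • EuclideanSpace.single i (1 : ℝ))) ∧
      (∀ n, (X n).card = n) ∧
      (fun n : ℕ => FacilityLocation.doublingDimension (X n)) =Θ[atTop]
        (fun n : ℕ => Real.log (n : ℝ)) ∧
      (∃ ε : ℕ → ℝ, Tendsto ε atTop (𝓝 0) ∧
        ∀ᶠ n in atTop,
          (2 / 3 : ℝ≥0∞) ≤ FacilityLocation.randomProjection n (d n)
            {G | FacilityLocation.optCost (FacilityLocation.projSet G (X n)) ≤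
              ε n * FacilityLocation.optCost (X n)}) ∧
      (∃ K : ℕ → ℝ, Tendsto K atTop atTop ∧
        ∀ᶠ n in atTop,
          (2 / 3 : ℝ≥0∞) ≤ FacilityLocation.randomProjection n (d n)
            {G | ∀ S, FacilityLocation.IsOptimal (FacilityLocation.projSet G (X n)) S →
              K n * FacilityLocation.optCost (X n) ≤
                FacilityLocation.cost (X n) (FacilityLocation.pullback G (X n) S)}) := by
  set R : ℕ → ℝ := fun n => scale n (d n)
  have hR (n : ℕ) : 0 < R n := one_pos.trans_le (one_le_scale n _)
  have hR_top : Tendsto R atTop atTop := tendsto_scale hd_pos hd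
  have hR_pow {n : ℕ} (hn : 0 < n) : R n ^ (4 * d n) = n := scale_pow hn (hd_pos n)
  refine ⟨R, fun n => scaledBasis n (R n), fun n => ⟨one_le_scale n _, coe_scaledBasis n _⟩,
    fun n => card_scaledBasis (hR n).ne', ?_, ⟨fun n => 8 / R n, hR_top.const_div_atTop 8, ?_⟩,
    ⟨fun n => R n / 2, hR_top.atTop_div_const two_pos, ?_⟩⟩
  · simp only [doublingDimension_scaledBasis (hR _), Real.logb, div_eq_inv_mul]
    exact (isTheta_refl _ _).const_mul_left (inv_ne_zero (Real.log_pos one_lt_two).ne')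
  · filter_upwards [eventually_gt_atTop 0, hR_top.eventually_ge_atTop 2] with n hn hRn
    exact two_thirds_le_measure_optCost_projSet_le hn (hd_pos n) hRn (hR_pow hn)
  · filter_upwards [eventually_gt_atTop 0, hR_top.eventually_ge_atTop 16] with n hn hRn
    exact two_thirds_le_measure_le_cost_pullback hn (hd_pos n) hRn (hR_pow hn)
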